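/- Let $d\ge 1$, $E=\{1,\dots,d\}$, and let $(X_t)_{t\in\mathbb{R}}$ be a stationary $E$-valued Markov process with càdlàg paths on a probability space $(\Omega,\mathcal F,\mathbf P)$, with transition intensities matrix $\Lambda=(\lambda_{ij})$ (that is, $\lambda_{ij}\ge 0$ for $i\ne j$, $\sum_j\lambda_{ij}=0$, and $\mathbf P(X_t=j\mid\sigma\{X_u:u\le s\})=(e^{(t-s)\Lambda})_{X_s j}$ a.s. for $s\le t$) and with stationary law $\pi_i=\mathbf P(X_0=i)>0$ for all $i$. Let $h\in\mathbb{R}^d$, viewed as a function $h:E\to\mathbb{R}$, $h(i)=h_i$. For a probability measure $\mu\ll\pi$ on $E$ put $\mathbf P^\mu(A)=\mathbf E\big(1_A\,\tfrac{d\mu}{d\pi}(X_0)\big)$. The model is called reconstructible if, for all probability measures $\mu,\nu\ll\pi$ on $E$ with $\mu\neq\nu$, the restrictions of $\mathbf P^\mu$ and $\mathbf P^\nu$ to the $\sigma$-algebra $\sigma\{h(X_s):s\le 0\}$ are different. Let $H=\mathrm{diag}(h)$, let $\mathbf 1=(1,\dots,1)^*$ be the column vector of ones, and let $\tilde\Lambda=(\tilde\lambda_{ij})$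 be the time-reversed transition intensities matrix, i.e. $\tilde\lambda_{ij}=\lambda_{ji}\pi_j/\pi_i$ for $i\neq j$ and $\tilde\lambda_{ii}=-\sum_{j\neq i}\tilde\lambda_{ij}$. Then the model is reconstructible if and only if $$\dim\Big(\mathrm{span}\big\{H^{n_0}\tilde\Lambda H^{n_1}\tilde\Lambda\cdots\tilde\Lambda H^{n_k}\mathbf 1:\ k,n_0,\dots,n_k\ge 0\big\}\Big)=d.$$ -/

import Mathlib

open MeasureTheory Set Filter Topology

noncomputable section

namespace FilterModel

/-- The σ-algebra `σ{Z_s : s ∈ I}` generated on `Ω` by the variables of a process with time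
parameter in `ℝ`. -/
@[reducible]
def sigmaGen {Ω S : Type*} [MeasurableSpace S] (Z : ℝ → Ω → S) (I : Set ℝ) :
    MeasurableSpace Ω :=
  ⨆ s ∈ I, MeasurableSpace.comap (Z s) inferInstance

/-- The path `x` is càdlàg: right-continuous, with left limits. -/
def IsCadlag {S : Type*} [TopologicalSpace S] (x : ℝ → S) : Prop :=
  ∀ t : ℝ, ContinuousWithinAt x (Ici t) t ∧ ∃ l : S, Tendsto x (𝓝[<] t) (𝓝 l)

/-- The measure `P^μ(A) = E(1_A (dμ/dπ)(X_0))`, where `π` is the law of `X_0` under `P`. -/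
def changeOfLaw {Ω S : Type*} [MeasurableSpace Ω] [MeasurableSpace S]
    (P : Measure Ω) (X : ℝ → Ω → S) (μ : Measure S) : Measure Ω :=
  P.withDensity (fun ω => μ.rnDeriv (P.map (X 0)) (X 0 ω))

/-- The signal `X` with observation function `h` is reconstructible: for distinct probability
measures `μ, ν ≪ π`, with `π` the law of `X_0`, the restrictions of `P^μ` and `P^ν` to the
σ-algebra `σ{h(X_s) : s ≤ 0}` are distinct. -/
def Reconstructible {Ω S O : Type*} [MeasurableSpace Ω] [MeasurableSpace S] [MeasurableSpace O]
    (P : Measure Ω) (X : ℝ → Ω → S) (h : S → O) : Prop :=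
  ∀ μ ν : Measure S, IsProbabilityMeasure μ → IsProbabilityMeasure ν →
    μ ≪ P.map (X 0) → ν ≪ P.map (X 0) → μ ≠ ν →
    ∃ A : Set Ω, MeasurableSet[sigmaGen (fun s ω => h (X s ω)) (Iic 0)] A ∧
      changeOfLaw P X μ A ≠ changeOfLaw P X ν A

/-- `Λ` is a transition intensities matrix: its off-diagonal entries are nonnegative and its rows
sum to zero. -/
def IsIntensityMatrix {d : ℕ} (Λ : Matrix (Fin d) (Fin d) ℝ) : Prop :=
  (∀ i j, i ≠ j → 0 ≤ Λ i j) ∧ ∀ i, ∑ j, Λ i j = 0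

/-- `X` is, under `P`, a stationary Markov process on a set of `d` points with càdlàg paths,
transition intensities matrix `Λ`, i.e. transition matrices `exp((t - s) Λ)`, and stationary
measure with weights `π`. -/
structure IsStationaryMarkov {Ω : Type*} [MeasurableSpace Ω] {d : ℕ} (P : Measure Ω)
    (X : ℝ → Ω → Fin d) (Λ : Matrix (Fin d) (Fin d) ℝ) (π : Fin d → ℝ) : Prop where
  intensity : IsIntensityMatrix Λ
  measurable : ∀ t, Measurable (X t)
  cadlag : ∀ ω, IsCadlag (fun t => X t ω)
  stationary : ∀ t : ℝ, P.map (fun ω s => X (s + t) ω) = P.map (fun ω s => X s ω)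
  law_zero : ∀ i, P.real (X 0 ⁻¹' {i}) = π i
  markov : ∀ s t : ℝ, s ≤ t → ∀ j : Fin d,
    P[(X t ⁻¹' {j}).indicator (fun _ => (1 : ℝ)) | sigmaGen X (Iic s)]
      =ᵐ[P] fun ω => NormedSpace.exp ((t - s) • Λ) (X s ω) j

/-- The time-reversed transition intensities matrix: its off-diagonal entries are
`Λ j i * π j / π i`, and its diagonal entries make the rows sum to zero. -/
def reversed {d : ℕ} (Λ : Matrix (Fin d) (Fin d) ℝ) (π : Fin d → ℝ) :
    Matrix (Fin d) (Fin d) ℝ :=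
  Matrix.of fun i j =>
    if i = j then -∑ k ∈ Finset.univ.erase i, Λ k i * π k / π i else Λ j i * π j / π i

/-- The product `H^{n₀} M H^{n₁} M ⋯ M H^{n_k}`, where `l = [n₁, …, n_k]`. -/
def word {d : ℕ} (H M : Matrix (Fin d) (Fin d) ℝ) (n₀ : ℕ) (l : List ℕ) :
    Matrix (Fin d) (Fin d) ℝ :=
  match l with
  | [] => H ^ n₀
  | n₁ :: l' => H ^ n₀ * M * word H M n₁ l'

end FilterModel

end

/-!
For an event `A` and a time `t`, consider the vector `q_{A,t}(i) = P(A | X_t = i)` (`condVec`).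
Writing `dμ/dπ` out on a finite state space gives `P^μ(A) = ∑ᵢ μᵢ q_{A,0}(i)`, so `μ` and `ν` induce
the same measure on the observed past exactly when `μ - ν` annihilates all `q_{A,0}` with `A` in
`σ{h(X_s) : s ≤ 0}`. Reconstructibility therefore says that these vectors separate the probability
measures, and the content of the theorem is that they have the same annihilator as the span `W` of
the vectors `H^{n₀} Λ~ H^{n₁} Λ~ ⋯ H^{n_k} 1`, where `Λ~` is the reversed intensity matrix.

Two facts govern the vectors `q`. If `A` is determined by the process up to time `s ≤ t`, the
Markov property gives `q_{A,t} = exp((t - s) Λ~) q_{A,s}` (`IsStationaryMarkov.condVec_eq_exp_mulVec`);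
here `Λ~` is the conjugate of the transpose of `Λ` by `diag π`, because `π Λ = 0`. Intersecting `A`
with `{h(X_t) ∈ B}` multiplies `q_{A,t}` by the diagonal matrix of `1_B ∘ h`
(`condVec_inter_preimage`). On the other side, `W` is the smallest subspace containing the constant
vector `1` and invariant under `H` and `Λ~`.

* A subspace invariant under `Λ~` and `H` is invariant under the matrices `exp(t Λ~)` and
  `diag(1_B ∘ h)`, the latter being polynomials in `H`. Hence `q_{A,0} ∈ W` for every cylinder event
  `A` of the observed past (`IsStationaryMarkov.condVec_cylinder_mem`). If `W` is proper, a nonzero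
  functional vanishing on `W` has total mass zero, as `1 ∈ W`; a small multiple of it, added to the
  uniform law, gives two laws that agree on the π-system of cylinders, hence on the σ-algebra.
* Conversely, the span of the vectors `q_{A,t}` attained at every time `t`
  (`reachable`) is invariant under `exp(t Λ~)` for `t ≥ 0` and under
  `diag(1_{y} ∘ h)`, thus, by differentiating at `t = 0`, under `Λ~` and `H`. So it contains `W`
  (`IsStationaryMarkov.wordSpan_le_span_reachable`), and if `W` is everything, then only `0`
  annihilates it.
-/

open MeasureTheory Set Filter Topology

namespace FilterModel

/-! ### Subspaces invariant under matrices -/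

section Invariance

variable {d : ℕ}

/-- The algebra of matrices `A` with `A W ⊆ W`. -/
def stabilizer (W : Submodule ℝ (Fin d → ℝ)) : Subalgebra ℝ (Matrix (Fin d) (Fin d) ℝ) where
  carrier := {A | ∀ v ∈ W, A.mulVec v ∈ W}
  mul_mem' := by
    intro A B hA hB v hv
    rw [← Matrix.mulVec_mulVec]
    exact hA _ (hB _ hv)
  add_mem' := by
    intro A B hA hB v hv
    rw [Matrix.add_mulVec]
    exact W.add_mem (hA _ hv) (hB _ hv)
  algebraMap_mem' := by
    intro r v hv
    rw [Algebra.algebraMap_eq_smul_one, Matrix.smul_mulVec, Matrix.one_mulVec]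
    exact W.smul_mem _ hv

theorem mem_stabilizer {W : Submodule ℝ (Fin d → ℝ)} {A : Matrix (Fin d) (Fin d) ℝ} :
    A ∈ stabilizer W ↔ ∀ v ∈ W, A.mulVec v ∈ W := Iff.rfl

/-- The stabilizer is a closed subalgebra, so it contains the exponentials of its elements. -/
theorem exp_smul_mem_stabilizer {W : Submodule ℝ (Fin d → ℝ)} {M : Matrix (Fin d) (Fin d) ℝ}
    (hM : M ∈ stabilizer W) (t : ℝ) : NormedSpace.exp (t • M) ∈ stabilizer W := by
  have hcl : IsClosed (stabilizer W : Set (Matrix (Fin d) (Fin d) ℝ)) := by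
    have : (stabilizer W : Set (Matrix (Fin d) (Fin d) ℝ))
        = ⋂ v ∈ W, (fun A : Matrix (Fin d) (Fin d) ℝ => A.mulVec v) ⁻¹' W := by
      ext A
      simp [mem_stabilizer]
    rw [this]
    refine isClosed_biInter fun v _ => W.closed_of_finiteDimensional.preimage ?_
    exact continuous_id.matrix_mulVec continuous_const
  exact NormedSpace.exp_mem hcl ((stabilizer W).smul_mem hM t)

theorem tendsto_exp_smul_slope (M : Matrix (Fin d) (Fin d) ℝ) :
    Tendsto (fun t : ℝ => t⁻¹ • (NormedSpace.exp (t • M) - 1)) (𝓝[>] 0) (𝓝 M) := by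
  open scoped Matrix.Norms.Operator in
  have h := (hasDerivAt_exp_smul_const (𝕂 := ℝ) M 0).tendsto_slope_zero_right
  simp only [zero_add, zero_smul, NormedSpace.exp_zero, one_mul] at h
  exact h

theorem tendsto_exp_smul_mulVec_slope (M : Matrix (Fin d) (Fin d) ℝ) (v : Fin d → ℝ) :
    Tendsto (fun t : ℝ => t⁻¹ • ((NormedSpace.exp (t • M)).mulVec v - v)) (𝓝[>] 0)
      (𝓝 (M.mulVec v)) := by
  have hc : Continuous fun A : Matrix (Fin d) (Fin d) ℝ => A.mulVec v :=
    continuous_id.matrix_mulVec continuous_const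
  refine ((hc.tendsto M).comp (tendsto_exp_smul_slope M)).congr fun t => ?_
  simp [Matrix.smul_mulVec, Matrix.sub_mulVec]

/-- A subspace invariant under the semigroup `exp (t M)`, `t ≥ 0`, is invariant under its generator:
`M v` is the limit of difference quotients lying in the (closed) subspace. -/
theorem mem_stabilizer_of_exp {W : Submodule ℝ (Fin d → ℝ)} {M : Matrix (Fin d) (Fin d) ℝ}
    (hM : ∀ t : ℝ, 0 ≤ t → NormedSpace.exp (t • M) ∈ stabilizer W) : M ∈ stabilizer W := by
  intro v hv
  refine W.closed_of_finiteDimensional.mem_of_tendsto (tendsto_exp_smul_mulVec_slope M v) ?_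
  filter_upwards [self_mem_nhdsWithin] with t ht
  exact W.smul_mem _ (W.sub_mem (hM t (le_of_lt ht) v hv) hv)

/-- As `h` takes finitely many values, `diag (f ∘ h)` is a polynomial in `diag h`, by Lagrange
interpolation. -/
theorem diagonal_comp_mem_stabilizer {W : Submodule ℝ (Fin d → ℝ)} {h : Fin d → ℝ}
    (hh : Matrix.diagonal h ∈ stabilizer W) (f : ℝ → ℝ) :
    Matrix.diagonal (f ∘ h) ∈ stabilizer W := by
  classical
  set p : Polynomial ℝ := Lagrange.interpolate (Finset.univ.image h) id f
  have hpe : Polynomial.aeval (Matrix.diagonal h) p = Matrix.diagonal (f ∘ h) := by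
    have h1 : ∀ q : Polynomial ℝ, Polynomial.aeval (Matrix.diagonal h) q
        = Matrix.diagonal fun i => q.eval (h i) := by
      intro q
      have := Polynomial.aeval_algHom_apply (Matrix.diagonalAlgHom ℝ (α := ℝ) (n := Fin d)) h q
      rw [Matrix.diagonalAlgHom_apply] at this
      rw [this, Matrix.diagonalAlgHom_apply]
      congr 1
      funext i
      simp
    rw [h1]
    congr 1
    funext i
    exact Lagrange.eval_interpolate_at_node (s := Finset.univ.image h) (v := id) f
      (fun _ _ _ _ hxy => hxy) (Finset.mem_image_of_mem h (Finset.mem_univ i))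
  rw [← hpe]
  exact Algebra.adjoin_le (Set.singleton_subset_iff.2 hh)
    (Polynomial.aeval_mem_adjoin_singleton ℝ _)

/-- `diag h` is the combination `∑ y, y • diag (1_{y} ∘ h)` over the values `y` of `h`. -/
theorem diagonal_mem_stabilizer_of_indicator {W : Submodule ℝ (Fin d → ℝ)} {h : Fin d → ℝ}
    (hB : ∀ y : ℝ, Matrix.diagonal (({y} : Set ℝ).indicator 1 ∘ h) ∈ stabilizer W) :
    Matrix.diagonal h ∈ stabilizer W := by
  classical
  have : Matrix.diagonal h
      = ∑ y ∈ Finset.univ.image h, y • Matrix.diagonal (({y} : Set ℝ).indicator 1 ∘ h) := by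
    ext i j
    rw [Matrix.sum_apply]
    by_cases hij : i = j
    · subst hij
      simp only [Matrix.smul_apply, Matrix.diagonal_apply_eq, Function.comp_apply, smul_eq_mul]
      rw [Finset.sum_eq_single (h i)]
      · simp
      · intro y _ hy
        simp [Ne.symm hy]
      · intro hi
        exact absurd (Finset.mem_image_of_mem h (Finset.mem_univ i)) hi
    · simp [hij]
  rw [this]
  exact sum_mem fun y _ => (stabilizer W).smul_mem (hB y) y

/-- The span of the vectors `H^{n₀} M H^{n₁} M ⋯ M H^{n_k} 1` with `H = diag h`. -/
def wordSpan (h : Fin d → ℝ) (M : Matrix (Fin d) (Fin d) ℝ) : Submodule ℝ (Fin d → ℝ) :=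
  Submodule.span ℝ {v : Fin d → ℝ | ∃ (n₀ : ℕ) (l : List ℕ),
    v = (word (Matrix.diagonal h) M n₀ l).mulVec 1}

theorem one_mem_wordSpan (h : Fin d → ℝ) (M : Matrix (Fin d) (Fin d) ℝ) :
    (1 : Fin d → ℝ) ∈ wordSpan h M :=
  Submodule.subset_span ⟨0, [], by simp [word]⟩

theorem mem_stabilizer_span {s : Set (Fin d → ℝ)} {A : Matrix (Fin d) (Fin d) ℝ}
    (hA : ∀ v ∈ s, A.mulVec v ∈ Submodule.span ℝ s) :
    A ∈ stabilizer (Submodule.span ℝ s) := by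
  have : Submodule.span ℝ s ≤ (Submodule.span ℝ s).comap A.mulVecLin :=
    Submodule.span_le.2 fun v hv => hA v hv
  exact fun v hv => this hv

theorem mul_word_eq (H M : Matrix (Fin d) (Fin d) ℝ) (n : ℕ) (l : List ℕ) :
    H * word H M n l = word H M (n + 1) l := by
  cases l <;> simp [word, pow_succ', mul_assoc]

theorem diagonal_mem_stabilizer_wordSpan (h : Fin d → ℝ) (M : Matrix (Fin d) (Fin d) ℝ) :
    Matrix.diagonal h ∈ stabilizer (wordSpan h M) := by
  refine mem_stabilizer_span ?_
  rintro _ ⟨n, l, rfl⟩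
  refine Submodule.subset_span ⟨n + 1, l, ?_⟩
  rw [Matrix.mulVec_mulVec, mul_word_eq]

theorem mem_stabilizer_wordSpan (h : Fin d → ℝ) (M : Matrix (Fin d) (Fin d) ℝ) :
    M ∈ stabilizer (wordSpan h M) := by
  refine mem_stabilizer_span ?_
  rintro _ ⟨n, l, rfl⟩
  refine Submodule.subset_span ⟨0, n :: l, ?_⟩
  rw [Matrix.mulVec_mulVec]
  simp [word]

theorem word_mem_of_mem {S : Subalgebra ℝ (Matrix (Fin d) (Fin d) ℝ)}
    {H M : Matrix (Fin d) (Fin d) ℝ} (hH : H ∈ S) (hM : M ∈ S) (n : ℕ) (l : List ℕ) :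
    word H M n l ∈ S := by
  induction l generalizing n with
  | nil => exact S.pow_mem hH n
  | cons m l ih => exact S.mul_mem (S.mul_mem (S.pow_mem hH n) hM) (ih m)

/-- With `one_mem_wordSpan`, `diagonal_mem_stabilizer_wordSpan` and `mem_stabilizer_wordSpan`: the
word span is the smallest subspace containing `1` and invariant under `diag h` and `M`. -/
theorem wordSpan_le {W : Submodule ℝ (Fin d → ℝ)} {h : Fin d → ℝ}
    {M : Matrix (Fin d) (Fin d) ℝ} (hone : (1 : Fin d → ℝ) ∈ W)
    (hh : Matrix.diagonal h ∈ stabilizer W) (hM : M ∈ stabilizer W) : wordSpan h M ≤ W := by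
  refine Submodule.span_le.2 ?_
  rintro _ ⟨n, l, rfl⟩
  exact word_mem_of_mem hh hM n l 1 hone

end Invariance

/-! ### Conditional probabilities of past events given the present state -/

section PastEvents

variable {Ω : Type*} {d : ℕ}

theorem measurable_sigmaGen {S : Type*} [MeasurableSpace S] (Z : ℝ → Ω → S) {I : Set ℝ} {s : ℝ}
    (hs : s ∈ I) : Measurable[sigmaGen Z I] (Z s) :=
  (comap_measurable (Z s)).mono (le_iSup₂_of_le s hs le_rfl) le_rfl

theorem sigmaGen_mono {S : Type*} [MeasurableSpace S] (Z : ℝ → Ω → S) {I J : Set ℝ}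
    (hIJ : I ⊆ J) : sigmaGen Z I ≤ sigmaGen Z J :=
  biSup_mono fun _ hs => hIJ hs

theorem sigmaGen_comp_le {S O : Type*} [MeasurableSpace S] [MeasurableSpace O] {h : S → O}
    (hh : Measurable h) (Z : ℝ → Ω → S) (I : Set ℝ) :
    sigmaGen (fun s ω => h (Z s ω)) I ≤ sigmaGen Z I :=
  iSup₂_le fun _ hs => (hh.comp (measurable_sigmaGen Z hs)).comap_le

theorem measurableSet_sigmaGen_biInter {S : Type*} [MeasurableSpace S] {Z : ℝ → Ω → S}
    {I : Set ℝ} {T : Finset ℝ} (hT : ↑T ⊆ I) {f : ℝ → Set Ω}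
    (hf : ∀ x ∈ T, MeasurableSet[MeasurableSpace.comap (Z x) inferInstance] (f x)) :
    MeasurableSet[sigmaGen Z I] (⋂ x ∈ T, f x) :=
  T.measurableSet_biInter fun x hx => le_iSup₂_of_le (f := fun s (_ : s ∈ I) =>
    MeasurableSpace.comap (Z s) inferInstance) x (hT hx) le_rfl _ (hf x hx)

variable [MeasurableSpace Ω]

theorem sigmaGen_le {S : Type*} [MeasurableSpace S] {Z : ℝ → Ω → S}
    (hZ : ∀ t, Measurable (Z t)) (I : Set ℝ) : sigmaGen Z I ≤ ‹MeasurableSpace Ω› :=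
  iSup₂_le fun s _ => (hZ s).comap_le

/-- The vector of conditional probabilities `P(A | X_t = i)`, where `π i` stands for `P(X_t = i)`, as
it does for every `t` under stationarity. -/
noncomputable def condVec (P : Measure Ω) (X : ℝ → Ω → Fin d) (π : Fin d → ℝ) (A : Set Ω) (t : ℝ) :
    Fin d → ℝ :=
  fun i => P.real (A ∩ X t ⁻¹' {i}) / π i

variable {P : Measure Ω} {X : ℝ → Ω → Fin d} {Λ : Matrix (Fin d) (Fin d) ℝ} {π : Fin d → ℝ}

theorem condVec_inter_preimage (h : Fin d → ℝ) (A : Set Ω) (B : Set ℝ) (t : ℝ) :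
    condVec P X π (A ∩ (fun ω => h (X t ω)) ⁻¹' B) t
      = (Matrix.diagonal (B.indicator 1 ∘ h)).mulVec (condVec P X π A t) := by
  funext i
  rw [Matrix.mulVec_diagonal, condVec, condVec, Function.comp_apply]
  by_cases hi : h i ∈ B
  · have : A ∩ (fun ω => h (X t ω)) ⁻¹' B ∩ X t ⁻¹' {i} = A ∩ X t ⁻¹' {i} := by
      ext ω
      simp only [mem_inter_iff, mem_preimage, mem_singleton_iff]
      constructor
      · tauto
      · rintro ⟨h1, rfl⟩
        exact ⟨⟨h1, hi⟩, rfl⟩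
    rw [this, indicator_of_mem hi, Pi.one_apply, one_mul]
  · have : A ∩ (fun ω => h (X t ω)) ⁻¹' B ∩ X t ⁻¹' {i} = ∅ := by
      ext ω
      simp only [mem_inter_iff, mem_preimage, mem_singleton_iff, mem_empty_iff_false, iff_false]
      rintro ⟨⟨_, h1⟩, rfl⟩
      exact hi h1
    rw [this, indicator_of_notMem hi]
    simp

/-- Every `X_t` has law `π`: the one-dimensional marginal of stationarity on path space. -/
theorem IsStationaryMarkov.real_preimage (hX : IsStationaryMarkov P X Λ π) (t : ℝ) (i : Fin d) :
    P.real (X t ⁻¹' {i}) = π i := by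
  have hm : ∀ u : ℝ, Measurable fun ω s => X (s + u) ω := fun u =>
    measurable_pi_lambda _ fun s => hX.measurable (s + u)
  have hm0 : Measurable fun ω s => X s ω := measurable_pi_lambda _ hX.measurable
  have hC : MeasurableSet ((fun x : ℝ → Fin d => x 0) ⁻¹' {i}) :=
    measurable_pi_apply (0 : ℝ) (measurableSet_singleton i)
  have h := congrArg (fun μ : Measure (ℝ → Fin d) => μ.real ((fun x => x 0) ⁻¹' {i}))
    (hX.stationary t)
  simp only [map_measureReal_apply (hm t) hC, map_measureReal_apply hm0 hC] at h
  rw [← hX.law_zero i]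
  simpa only [← preimage_comp, Function.comp_def, zero_add] using h

theorem IsStationaryMarkov.condVec_univ (hX : IsStationaryMarkov P X Λ π) (hπ : ∀ i, 0 < π i)
    (t : ℝ) : condVec P X π univ t = 1 := by
  funext i
  simp [condVec, hX.real_preimage, (hπ i).ne']

variable [IsProbabilityMeasure P]

theorem setIntegral_comp_eq_sum (g : Fin d → ℝ) (t : ℝ) (A : Set Ω)
    (hXt : Measurable (X t)) :
    ∫ ω in A, g (X t ω) ∂P = ∑ i, P.real (A ∩ X t ⁻¹' {i}) * g i := by
  rw [← integral_map (φ := X t) (f := g) hXt.aemeasurable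
      (Measurable.of_discrete.aestronglyMeasurable),
    integral_fintype (Integrable.of_finite)]
  refine Finset.sum_congr rfl fun i _ => ?_
  rw [map_measureReal_apply hXt (measurableSet_singleton i),
    measureReal_restrict_apply (hXt (measurableSet_singleton i)), inter_comm, smul_eq_mul]

/-- The Markov property integrated over an event `A` of the past of time `s`. -/
theorem IsStationaryMarkov.real_inter_preimage (hX : IsStationaryMarkov P X Λ π) {s t : ℝ}
    (hst : s ≤ t) {A : Set Ω} (hA : MeasurableSet[sigmaGen X (Iic s)] A) (j : Fin d) :
    P.real (A ∩ X t ⁻¹' {j})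
      = ∑ i, P.real (A ∩ X s ⁻¹' {i}) * NormedSpace.exp ((t - s) • Λ) i j := by
  have hle := sigmaGen_le hX.measurable (Iic s)
  have hj : MeasurableSet (X t ⁻¹' {j}) := hX.measurable t (measurableSet_singleton j)
  have h1 := setIntegral_condExp hle
    (f := (X t ⁻¹' {j}).indicator fun _ => (1 : ℝ)) (μ := P)
    ((integrable_const 1).indicator hj) hA
  rw [setIntegral_congr_ae (hle A hA) ((hX.markov s t hst j).mono fun ω hω _ => hω),
    setIntegral_comp_eq_sum (fun i => NormedSpace.exp ((t - s) • Λ) i j) s A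
      (hX.measurable s)] at h1
  rw [h1, setIntegral_indicator hj]
  simp

/-- When `π` is invariant, the reversed matrix is the conjugate of `Λᵀ` by `diag π`. Invariance is
what makes the diagonal entries of the two sides agree. -/
theorem reversed_eq_of_vecMul_eq_zero (hπ : ∀ i, 0 < π i) (h0 : Matrix.vecMul π Λ = 0) :
    reversed Λ π = (Matrix.diagonal π)⁻¹ * Λ.transpose * Matrix.diagonal π := by
  have hinv : (Matrix.diagonal π)⁻¹ = Matrix.diagonal fun i => (π i)⁻¹ := by
    refine Matrix.inv_eq_left_inv ?_
    rw [Matrix.diagonal_mul_diagonal, ← Matrix.diagonal_one]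
    congr 1
    funext i
    exact inv_mul_cancel₀ (hπ i).ne'
  rw [hinv]
  ext i j
  rw [Matrix.mul_diagonal, Matrix.diagonal_mul, Matrix.transpose_apply, reversed, Matrix.of_apply]
  split_ifs with hij
  · subst hij
    have h1 : ∑ k, Λ k i * π k = 0 := by
      have := congrFun h0 i
      simpa [Matrix.vecMul, dotProduct, mul_comm] using this
    rw [← Finset.add_sum_erase _ _ (Finset.mem_univ i)] at h1
    rw [← Finset.sum_div]
    have := (hπ i).ne'
    field_simp
    linarith
  · ring

/-- The law `π` is invariant, `π Λ = 0`: differentiate `π exp(t Λ) = π` at `t = 0` from the right. -/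
theorem IsStationaryMarkov.vecMul_eq_zero (hX : IsStationaryMarkov P X Λ π) :
    Matrix.vecMul π Λ = 0 := by
  rw [← Matrix.mulVec_transpose]
  refine tendsto_nhds_unique (tendsto_exp_smul_mulVec_slope Λ.transpose π)
    (tendsto_const_nhds.congr' ?_)
  filter_upwards [self_mem_nhdsWithin] with t ht
  have : (NormedSpace.exp (t • Λ.transpose)).mulVec π = π := by
    rw [← Matrix.transpose_smul, Matrix.exp_transpose, Matrix.mulVec_transpose]
    funext j
    have h := hX.real_inter_preimage (le_of_lt ht) MeasurableSet.univ j
    simp only [univ_inter, hX.real_preimage, sub_zero] at h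
    exact h.symm
  rw [this, sub_self, smul_zero]

/-- The Markov property in reversed time: the conditional probabilities of a past event given the
present state evolve by the semigroup of the reversed intensity matrix. -/
theorem IsStationaryMarkov.condVec_eq_exp_mulVec (hX : IsStationaryMarkov P X Λ π)
    (hπ : ∀ i, 0 < π i) {s t : ℝ} (hst : s ≤ t) {A : Set Ω}
    (hA : MeasurableSet[sigmaGen X (Iic s)] A) :
    condVec P X π A t
      = (NormedSpace.exp ((t - s) • reversed Λ π)).mulVec (condVec P X π A s) := by
  have hD : IsUnit (Matrix.diagonal π) := by
    rw [Matrix.isUnit_diagonal, Pi.isUnit_iff]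
    exact fun i => (hπ i).ne'.isUnit
  have hDdet := (Matrix.isUnit_iff_isUnit_det _).1 hD
  have key : ∀ u, (Matrix.diagonal π).mulVec (condVec P X π A u)
      = fun i => P.real (A ∩ X u ⁻¹' {i}) := by
    intro u
    funext i
    rw [Matrix.mulVec_diagonal]
    exact mul_div_cancel₀ _ (hπ i).ne'
  have hexp : NormedSpace.exp ((t - s) • reversed Λ π)
      = (Matrix.diagonal π)⁻¹ * (NormedSpace.exp ((t - s) • Λ)).transpose
        * Matrix.diagonal π := by
    rw [reversed_eq_of_vecMul_eq_zero hπ hX.vecMul_eq_zero, ← Matrix.exp_transpose,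
      ← Matrix.exp_conj' _ _ hD, Matrix.transpose_smul, Matrix.mul_smul, Matrix.smul_mul]
  rw [hexp, ← Matrix.mulVec_mulVec, ← Matrix.mulVec_mulVec, key, Matrix.mulVec_transpose]
  have : Matrix.vecMul (fun i => P.real (A ∩ X s ⁻¹' {i})) (NormedSpace.exp ((t - s) • Λ))
      = (Matrix.diagonal π).mulVec (condVec P X π A t) := by
    rw [key]
    funext j
    exact (hX.real_inter_preimage hst hA j).symm
  rw [this, Matrix.mulVec_mulVec, Matrix.nonsing_inv_mul _ hDdet, Matrix.one_mulVec]

end PastEvents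

/-! ### Separation of initial laws by observed events -/

section Duality

variable {Ω : Type*} [MeasurableSpace Ω] {d : ℕ} {P : Measure Ω} [IsProbabilityMeasure P]
  {X : ℝ → Ω → Fin d} {Λ : Matrix (Fin d) (Fin d) ℝ} {π : Fin d → ℝ}

theorem IsStationaryMarkov.map_singleton (hX : IsStationaryMarkov P X Λ π) (i : Fin d) :
    P.map (X 0) {i} = ENNReal.ofReal (π i) := by
  rw [Measure.map_apply (hX.measurable 0) (measurableSet_singleton i), ← hX.law_zero i,
    ofReal_measureReal]

theorem IsStationaryMarkov.absolutelyContinuous (hX : IsStationaryMarkov P X Λ π)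
    (hπ : ∀ i, 0 < π i) (μ : Measure (Fin d)) : μ ≪ P.map (X 0) := by
  intro s hs
  suffices s = ∅ by simp [this]
  refine eq_empty_of_forall_notMem fun i hi => ?_
  have h0 := measure_mono_null (singleton_subset_iff.2 hi) hs
  rw [hX.map_singleton] at h0
  exact (ENNReal.ofReal_pos.2 (hπ i)).ne' h0

/-- `P^μ(A) = ∑ᵢ μᵢ P(A | X_0 = i)`. -/
theorem IsStationaryMarkov.changeOfLaw_real (hX : IsStationaryMarkov P X Λ π)
    (hπ : ∀ i, 0 < π i) (μ : Measure (Fin d)) [IsProbabilityMeasure μ] {A : Set Ω}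
    (hA : MeasurableSet A) :
    (changeOfLaw P X μ).real A = (fun i => μ.real {i}) ⬝ᵥ condVec P X π A 0 := by
  have : IsProbabilityMeasure (P.map (X 0)) :=
    Measure.isProbabilityMeasure_map (hX.measurable 0).aemeasurable
  set r := μ.rnDeriv (P.map (X 0))
  have hri : ∀ i, r i * ENNReal.ofReal (π i) = μ {i} := by
    intro i
    have h := Measure.withDensity_rnDeriv_eq _ _ (hX.absolutelyContinuous hπ μ)
    rw [← hX.map_singleton, ← lintegral_singleton, ← withDensity_apply _
      (measurableSet_singleton i), h]
  -- The density is finite at each point, as `π i > 0`, so passing to real numbers loses nothing.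
  have hfin : ∀ i, r i * P (A ∩ X 0 ⁻¹' {i}) ≠ ⊤ := by
    intro i
    refine ENNReal.mul_ne_top (fun htop => ?_) (measure_ne_top _ _)
    have := hri i
    rw [htop, ENNReal.top_mul (ENNReal.ofReal_pos.2 (hπ i)).ne'] at this
    exact measure_ne_top μ {i} this.symm
  have h1 : changeOfLaw P X μ A = ∑ i, r i * P (A ∩ X 0 ⁻¹' {i}) := by
    rw [changeOfLaw, withDensity_apply _ hA,
      ← lintegral_map (Measurable.of_discrete (f := r)) (hX.measurable 0), lintegral_fintype]
    refine Finset.sum_congr rfl fun i _ => ?_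
    have hi := hX.measurable 0 (measurableSet_singleton i)
    rw [Measure.map_apply (hX.measurable 0) (measurableSet_singleton i),
      Measure.restrict_apply hi, inter_comm]
  rw [measureReal_def, h1, ENNReal.toReal_sum fun i _ => hfin i]
  refine Finset.sum_congr rfl fun i _ => ?_
  have := (hπ i).ne'
  simp only [condVec]
  rw [ENNReal.toReal_mul, measureReal_def μ, ← hri i, ENNReal.toReal_mul,
    ENNReal.toReal_ofReal (hπ i).le, measureReal_def P]
  field_simp

theorem IsStationaryMarkov.isProbabilityMeasure_changeOfLaw (hX : IsStationaryMarkov P X Λ π)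
    (hπ : ∀ i, 0 < π i) (μ : Measure (Fin d)) [IsProbabilityMeasure μ] :
    IsProbabilityMeasure (changeOfLaw P X μ) := by
  refine ⟨?_⟩
  have h := hX.changeOfLaw_real hπ μ MeasurableSet.univ
  rw [hX.condVec_univ hπ, dotProduct_one, sum_measureReal_singleton, Finset.coe_univ,
    probReal_univ (μ := μ)] at h
  simpa [measureReal_def, ENNReal.toReal_eq_one_iff] using h

variable (P X π) in
/-- The vectors that, at every time `t`, are the conditional probabilities given `X_t` of some event
observed up to time `t`. Asking for an event at each `t` replaces shifting events in time, so that
the set is visibly stable under the semigroup. -/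
def reachable (h : Fin d → ℝ) : Set (Fin d → ℝ) :=
  {v | ∀ t, ∃ A, MeasurableSet[sigmaGen (fun s ω => h (X s ω)) (Iic t)] A ∧ condVec P X π A t = v}

theorem IsStationaryMarkov.wordSpan_le_span_reachable (hX : IsStationaryMarkov P X Λ π)
    (hπ : ∀ i, 0 < π i) (h : Fin d → ℝ) :
    wordSpan h (reversed Λ π) ≤ Submodule.span ℝ (reachable P X π h) := by
  refine wordSpan_le ?_ ?_ ?_
  · exact Submodule.subset_span fun t => ⟨univ, MeasurableSet.univ, hX.condVec_univ hπ t⟩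
  · refine diagonal_mem_stabilizer_of_indicator fun y => mem_stabilizer_span fun v hv => ?_
    refine Submodule.subset_span fun t => ?_
    obtain ⟨A, hA, rfl⟩ := hv t
    exact ⟨_, hA.inter (measurable_sigmaGen (fun s ω => h (X s ω)) self_mem_Iic
      (measurableSet_singleton y)), condVec_inter_preimage h A {y} t⟩
  · refine mem_stabilizer_of_exp fun u hu => mem_stabilizer_span fun v hv => ?_
    refine Submodule.subset_span fun t => ?_
    obtain ⟨A, hA, rfl⟩ := hv (t - u)
    have htu : t - u ≤ t := sub_le_self t hu
    refine ⟨A, sigmaGen_mono _ (Iic_subset_Iic.2 htu) _ hA, ?_⟩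
    rw [hX.condVec_eq_exp_mulVec hπ htu
      (sigmaGen_comp_le (Measurable.of_discrete) X _ _ hA), sub_sub_cancel]

/-- Cylinder events of the observed past have conditional probabilities in the word span. The
induction adds the latest observation time `a` to a finite set of earlier ones: move to time `a` by
the semigroup, then restrict to the event observed at time `a`. -/
theorem IsStationaryMarkov.condVec_cylinder_mem (hX : IsStationaryMarkov P X Λ π)
    (hπ : ∀ i, 0 < π i) (h : Fin d → ℝ) (T : Finset ℝ) (f : ℝ → Set Ω) (t : ℝ)
    (hT : ↑T ⊆ Iic t) (hf : ∀ x ∈ T,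
      MeasurableSet[MeasurableSpace.comap (fun ω => h (X x ω)) inferInstance] (f x)) :
    condVec P X π (⋂ x ∈ T, f x) t ∈ wordSpan h (reversed Λ π) := by
  induction T using Finset.induction_on_max generalizing t with
  | empty => simpa [hX.condVec_univ hπ] using one_mem_wordSpan h (reversed Λ π)
  | insert a T ha ih =>
    have hsub : ↑T ⊆ Iic a := fun x hx => (ha x hx).le
    have hat : a ≤ t := hT (Finset.mem_insert_self a T)
    have hmem := ih a hsub fun x hx => hf x (Finset.mem_insert_of_mem hx)
    obtain ⟨B, hB, hBa⟩ := hf a (Finset.mem_insert_self a T)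
    have hA : MeasurableSet[sigmaGen X (Iic a)] (⋂ x ∈ insert a T, f x) := by
      refine sigmaGen_comp_le (h := h) Measurable.of_discrete X _ _
        (measurableSet_sigmaGen_biInter ?_ hf)
      rw [Finset.coe_insert]
      exact insert_subset self_mem_Iic hsub
    rw [hX.condVec_eq_exp_mulVec hπ hat hA, Finset.set_biInter_insert, ← hBa, inter_comm,
      condVec_inter_preimage]
    exact exp_smul_mem_stabilizer (mem_stabilizer_wordSpan h _) _ _
      (diagonal_comp_mem_stabilizer (diagonal_mem_stabilizer_wordSpan h _) _ _ hmem)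

/-- Laws that agree as functionals on the word span are not distinguished by the observed past. -/
theorem IsStationaryMarkov.changeOfLaw_eq_of_forall_dotProduct_eq
    (hX : IsStationaryMarkov P X Λ π) (hπ : ∀ i, 0 < π i) (h : Fin d → ℝ)
    (μ ν : Measure (Fin d)) [IsProbabilityMeasure μ] [IsProbabilityMeasure ν]
    (hμν : ∀ v ∈ wordSpan h (reversed Λ π),
      (fun i => μ.real {i}) ⬝ᵥ v = (fun i => ν.real {i}) ⬝ᵥ v)
    {A : Set Ω} (hA : MeasurableSet[sigmaGen (fun s ω => h (X s ω)) (Iic 0)] A) :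
    changeOfLaw P X μ A = changeOfLaw P X ν A := by
  have := hX.isProbabilityMeasure_changeOfLaw hπ μ
  have := hX.isProbabilityMeasure_changeOfLaw hπ ν
  have hle : sigmaGen (fun s ω => h (X s ω)) (Iic 0) ≤ ‹MeasurableSpace Ω› :=
    sigmaGen_le (fun t => Measurable.of_discrete.comp (hX.measurable t)) _
  rw [← trim_measurableSet_eq hle hA, ← trim_measurableSet_eq hle hA]
  congr 1
  refine ext_of_generate_finite _ (generateFrom_piiUnionInter_measurableSet
    (fun s => MeasurableSpace.comap (fun ω => h (X s ω)) inferInstance) (Iic 0)).symm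
    (isPiSystem_piiUnionInter _ (fun s => @MeasurableSpace.isPiSystem_measurableSet _
      (MeasurableSpace.comap (fun ω => h (X s ω)) inferInstance)) _) ?_ ?_
  · rintro _ ⟨T, hT, f, hf, rfl⟩
    have hm : MeasurableSet[sigmaGen (fun s ω => h (X s ω)) (Iic 0)] (⋂ x ∈ T, f x) :=
      measurableSet_sigmaGen_biInter hT hf
    rw [trim_measurableSet_eq hle hm, trim_measurableSet_eq hle hm, ← measureReal_eq_measureReal_iff,
      hX.changeOfLaw_real hπ μ (hle _ hm), hX.changeOfLaw_real hπ ν (hle _ hm)]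
    exact hμν _ (hX.condVec_cylinder_mem hπ h T f 0 hT hf)
  · rw [trim_measurableSet_eq hle MeasurableSet.univ, trim_measurableSet_eq hle MeasurableSet.univ,
      measure_univ, measure_univ]

theorem measure_eq_of_real_singleton_eq {μ ν : Measure (Fin d)} [IsFiniteMeasure μ]
    [IsFiniteMeasure ν] (hμν : ∀ i, μ.real {i} = ν.real {i}) : μ = ν :=
  Measure.ext_of_singleton fun i => (measureReal_eq_measureReal_iff).1 (hμν i)

theorem IsStationaryMarkov.reconstructible_of_wordSpan_eq_top
    (hX : IsStationaryMarkov P X Λ π) (hπ : ∀ i, 0 < π i) {h : Fin d → ℝ}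
    (htop : wordSpan h (reversed Λ π) = ⊤) : Reconstructible P X h := by
  intro μ ν _ _ _ _ hne
  by_contra! hall
  refine hne (measure_eq_of_real_singleton_eq fun i => ?_)
  have hle : sigmaGen (fun s ω => h (X s ω)) (Iic 0) ≤ ‹MeasurableSpace Ω› :=
    sigmaGen_le (fun t => Measurable.of_discrete.comp (hX.measurable t)) _
  have hspan : ∀ v ∈ Submodule.span ℝ (reachable P X π h),
      (fun i => μ.real {i}) ⬝ᵥ v = (fun i => ν.real {i}) ⬝ᵥ v := by
    intro v hv
    induction hv using Submodule.span_induction with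
    | mem v hv =>
      obtain ⟨A, hA, rfl⟩ := hv 0
      rw [← hX.changeOfLaw_real hπ μ (hle A hA), ← hX.changeOfLaw_real hπ ν (hle A hA),
        measureReal_def, measureReal_def, hall A hA]
    | zero => simp
    | add v w _ _ hv hw => rw [dotProduct_add, dotProduct_add, hv, hw]
    | smul r v _ hv => rw [dotProduct_smul, dotProduct_smul, hv]
  have hmem : Pi.single i (1 : ℝ) ∈ Submodule.span ℝ (reachable P X π h) :=
    hX.wordSpan_le_span_reachable hπ h (htop ▸ Submodule.mem_top)
  simpa using hspan _ hmem

theorem exists_probabilityMeasure_real_singleton {p : Fin d → ℝ} (hp : ∀ i, 0 ≤ p i)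
    (hsum : ∑ i, p i = 1) :
    ∃ μ : Measure (Fin d), IsProbabilityMeasure μ ∧ ∀ i, μ.real {i} = p i := by
  refine ⟨(PMF.ofFintype (fun i => ENNReal.ofReal (p i)) ?_).toMeasure, inferInstance, fun i => ?_⟩
  · rw [← ENNReal.ofReal_sum_of_nonneg fun i _ => hp i, hsum, ENNReal.ofReal_one]
  · rw [measureReal_def, PMF.toMeasure_apply_singleton _ _ (measurableSet_singleton i),
      PMF.ofFintype_apply, ENNReal.toReal_ofReal (hp i)]

/-- A nonzero vector of total mass zero is, up to a factor, the difference of two probability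
measures: the uniform law and a small perturbation of it. -/
theorem exists_ne_probabilityMeasure_of_sum_eq_zero {c : Fin d → ℝ} (hc : c ≠ 0)
    (hsum : ∑ i, c i = 0) :
    ∃ μ ν : Measure (Fin d), IsProbabilityMeasure μ ∧ IsProbabilityMeasure ν ∧ μ ≠ ν ∧
      ∃ r : ℝ, ∀ i, μ.real {i} - ν.real {i} = r * c i := by
  obtain ⟨i₀, hi₀⟩ := Function.ne_iff.1 hc
  have hd : (0 : ℝ) < d := Nat.cast_pos.2 (Fin.pos i₀)
  set s := ∑ i, |c i|
  have hs0 : 0 ≤ s := Finset.sum_nonneg fun i _ => abs_nonneg _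
  have hle : ∀ i, |c i| ≤ s := fun i =>
    Finset.single_le_sum (f := fun i => |c i|) (fun j _ => abs_nonneg _) (Finset.mem_univ i)
  -- `r |c i| ≤ r s < 1 / d` keeps the perturbed weights nonnegative.
  set r : ℝ := (d * (1 + s))⁻¹ with hr
  have hr0 : 0 < r := by positivity
  have hcard : ∑ _i : Fin d, (d : ℝ)⁻¹ = 1 := by simp [hd.ne']
  obtain ⟨ν, hν, hνi⟩ := exists_probabilityMeasure_real_singleton
    (p := fun _ : Fin d => (d : ℝ)⁻¹) (fun _ => by positivity) hcard
  obtain ⟨μ, hμ, hμi⟩ := exists_probabilityMeasure_real_singleton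
    (p := fun i : Fin d => (d : ℝ)⁻¹ + r * c i) (fun i => by
      have h1 : (d : ℝ)⁻¹ = r * (1 + s) := by rw [hr]; field_simp
      rw [h1, ← mul_add]
      have := (abs_le.1 (hle i)).1
      exact mul_nonneg hr0.le (by linarith))
    (by rw [Finset.sum_add_distrib, hcard, ← Finset.mul_sum, hsum, mul_zero, add_zero])
  refine ⟨μ, ν, hμ, hν, fun h => ?_, r, fun i => by rw [hμi, hνi]; ring⟩
  have h1 := hμi i₀
  rw [h, hνi, left_eq_add] at h1
  exact mul_ne_zero hr0.ne' hi₀ h1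

theorem IsStationaryMarkov.wordSpan_eq_top_of_reconstructible
    (hX : IsStationaryMarkov P X Λ π) (hπ : ∀ i, 0 < π i) {h : Fin d → ℝ}
    (hrec : Reconstructible P X h) : wordSpan h (reversed Λ π) = ⊤ := by
  by_contra hne
  obtain ⟨φ, hφ, hker⟩ := Submodule.exists_le_ker_of_lt_top _ (lt_top_iff_ne_top.2 hne)
  -- Every functional on `Fin d → ℝ` is the dot product with a vector `c`.
  obtain ⟨c, rfl⟩ := (dotProductEquiv ℝ (Fin d)).surjective φ
  have hc : ∀ v ∈ wordSpan h (reversed Λ π), c ⬝ᵥ v = 0 := fun v hv => hker hv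
  have hc0 : c ≠ 0 := by
    rintro rfl
    exact hφ (map_zero _)
  have hsum : ∑ i, c i = 0 := by
    simpa [dotProduct_one] using hc 1 (one_mem_wordSpan h _)
  obtain ⟨μ, ν, hμ, hν, hμν, r, hr⟩ := exists_ne_probabilityMeasure_of_sum_eq_zero hc0 hsum
  obtain ⟨A, hA, hAne⟩ := hrec μ ν hμ hν (hX.absolutelyContinuous hπ μ)
    (hX.absolutelyContinuous hπ ν) hμν
  refine hAne (hX.changeOfLaw_eq_of_forall_dotProduct_eq hπ h μ ν (fun v hv => ?_) hA)
  have hdiff : (fun i => μ.real {i}) - (fun i => ν.real {i}) = r • c := funext hr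
  rw [← sub_eq_zero, ← sub_dotProduct, hdiff, smul_dotProduct, hc v hv, smul_zero]

end Duality

end FilterModel

theorem lemma4p3 {Ω : Type*} [MeasurableSpace Ω] (P : MeasureTheory.Measure Ω)
    [MeasureTheory.IsProbabilityMeasure P] (d : ℕ) (X : ℝ → Ω → Fin d)
    (Λ : Matrix (Fin d) (Fin d) ℝ) (π : Fin d → ℝ) (h : Fin d → ℝ)
    (hπ : ∀ i, 0 < π i) (hX : FilterModel.IsStationaryMarkov P X Λ π) :
    FilterModel.Reconstructible P X h ↔
      Module.finrank ℝ (Submodule.span ℝ {v : Fin d → ℝ | ∃ (n₀ : ℕ) (l : List ℕ),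
        v = (FilterModel.word (Matrix.diagonal h) (FilterModel.reversed Λ π) n₀ l).mulVec 1}) = d := by
  have htop : Module.finrank ℝ (FilterModel.wordSpan h (FilterModel.reversed Λ π)) = d ↔
      FilterModel.wordSpan h (FilterModel.reversed Λ π) = ⊤ := by
    refine ⟨fun hfin => Submodule.eq_top_of_finrank_eq ?_, fun hW => ?_⟩
    · rw [hfin, Module.finrank_fin_fun]
    · rw [hW, finrank_top, Module.finrank_fin_fun]
  exact ⟨fun hrec => htop.2 (hX.wordSpan_eq_top_of_reconstructible hπ hrec),
    fun hfin => hX.reconstructible_of_wordSpan_eq_top hπ (htop.1 hfin)⟩
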